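/- Let $n\ge 0$, let $H_n=\mathbb{F}_2^n$ with Hamming distance $d(\cdot,\cdot)$, and let $C\subset H_n$. For $x_1,x_2,x_3\in H_n$ let $d(x_1,x_2,x_3)$ be the number of coordinates where $x_1,x_2,x_3$ are not all equal, $r(x_1,x_2,x_3)=\min_{y\in H_n}\max_i d(y,x_i)$ and $\overline r(x_1,x_2,x_3)=\min_{y\in H_n}\frac13\sum_i d(y,x_i)$. For $f=d,r,\overline r$ let $f_2(C)=\min f(x_1,x_2,x_3)$ over all triples of pairwise distinct elements of $C$ (with $f_2(C)=+\infty$ if there is no such triple). Let $\Omega$ be the set of $(a,b,c)\in\{0,\dots,n\}^3$ with $a+b+c$ even, $a+b+c\le 2n$, $c\le a+b$, $b\le a+c$, $a\le b+c$. For $(a,b,c)\in\Omega$ let $t(a,b,c)=\binom{c}{i}\binom{n-c}{a-i}$, where $2i=a-b+c$. For $0\le s\le t\le n$ and $0\le k\le\min(s,n-t)$ let $Q_k(n,s,t;\cdot)$ be the Hahn polynomial: the unique real polynomial of degree $k$ with value $1$ at $0$ that is orthogonal to all polynomials of degree $<k$ for the weights $w(n,s,t;i)=\binom{s}{i}\binom{n-s}{t-s+i}$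 on the points $i=0,\dots,s$. For $0\le k\le\lfloor n/2\rfloor$ and $(a,b,c)\in\Omega$ let $T_k(a,b,c)$ be the real matrix with rows and columns indexed by $\{k,\dots,n-k\}$ all of whose entries are $0$ except, when $k\le a,b\le n-k$, the entry in row $b$ and column $a$, which is $$2^n\,\frac{\binom{v-k}{u-k}\binom{n-2k}{v-k}}{\binom nv\binom vu}\;Q_k\!\left(n,u,v;\;u-\tfrac{a+b-c}{2}\right),\qquad u=\min(a,b),\quad v=\max(a,b).$$ Consider the semidefinite program in real variables $x_{a,b,c}$, $(a,b,c)\in\Omega$: maximize $\sum_{c=0}^n x_{0,c,c}$ subject to (i) $x_{0,0,0}=1$; (ii) $x_{a,b,c}\ge 0$; (iii) $x_{a,b,c}$ is invariant under all permutations of $(a,b,c)$; (iv) $x_{a,b,c}\le t(a,b,c)\,x_{0,c,c}$; (v) $x_{a,b,c}\le t(b,c,a)\,x_{0,a,a}$; (vi) $x_{a,b,c}\le t(c,a,b)\,x_{0,b,b}$; (vii) $\sum_{(a,b,c)\in\Omega}x_{a,b,c}\,T_k(a,b,c)\succeq 0$ for all $0\le k\le\lfloor n/2\rfloor$; (viii)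 $\sum_{(a,b,c)\in\Omega}\bigl(t(a,b,c)\,x_{0,c,c}-x_{a,b,c}\bigr)T_k(a,b,c)\succeq 0$ for all $0\le k\le\lfloor n/2\rfloor$; and one of the following conditions, where $d,r\ge 0$ are integers and $\overline r$ is a real number: (ix)$^d$ $x_{a,b,c}=0$ if $abc\ne 0$ and $a+b+c\le 2(d-1)$; (ix)$^r$ $x_{a,b,c}=0$ if $abc\ne 0$ and $\max(\lceil a/2\rceil,\lceil b/2\rceil,\lceil c/2\rceil)\le r-1$; (ix)$^{\overline r}$ $x_{a,b,c}=0$ if $abc\ne 0$ and $a+b+c<6\overline r$. Suppose that $d_2(C)\ge d$ (respectively $r_2(C)\ge r$, respectively $\overline r_2(C)\ge\overline r$). Then the program with (i)-(viii) and (ix)$^d$ (respectively (ix)$^r$, (ix)$^{\overline r}$) attains a finite maximum, and $|C|$ is at most this maximum. Moreover, if $C\neq\emptyset$, the numbers $$x_{a,b,c}=\frac1{|C|}\operatorname{card}\{(x,y,z)\in C^3: d(y,z)=a,\ d(x,z)=b,\ d(x,y)=c\}$$ form a feasible point of this program with $\sum_c x_{0,c,c}=|C|$. -/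

import Mathlib

noncomputable section

open Polynomial

/-! ### Binary Hamming space, pseudo-distances and code invariants -/

/-- The binary Hamming space `𝔽₂ⁿ`; its metric is `hammingDist`. -/
abbrev BinHamming (n : ℕ) : Type := Fin n → ZMod 2

/-- Generalized Hamming distance: the number of coordinates where the points are not all equal. -/
def genDist {n k : ℕ} (x : Fin k → BinHamming n) : ℕ :=
  (Finset.univ.filter fun j : Fin n => ∃ i i' : Fin k, x i j ≠ x i' j).card

/-- Radius: the smallest radius of a Hamming ball that contains all the points. -/
def radius {n k : ℕ} (x : Fin k → BinHamming n) : ℕ :=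
  sInf {r : ℕ | ∃ y : BinHamming n, ∀ i, hammingDist y (x i) ≤ r}

/-- Average radius: the minimum over all centers of the mean distance to the points
(the infimum is over a finite nonempty type). -/
def avgRadius {n k : ℕ} (x : Fin k → BinHamming n) : ℝ :=
  ⨅ y : BinHamming n, (1 / (k : ℝ)) * ∑ i, (hammingDist y (x i) : ℝ)

/-- Minimum of `f` over the `k`-tuples of pairwise distinct elements of `C`; it is `⊤` if there
are none, so that small codes satisfy every lower bound. -/
def codeMin {n k : ℕ} (f : (Fin k → BinHamming n) → ℝ) (C : Finset (BinHamming n)) : EReal :=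
  ⨅ x : {x : Fin k → BinHamming n // Function.Injective x ∧ ∀ i, x i ∈ C}, ((f x.1 : ℝ) : EReal)

/-- The invariant `d₂(C)`. -/
def d₂ {n : ℕ} (C : Finset (BinHamming n)) : EReal :=
  codeMin (fun x : Fin 3 → BinHamming n => (genDist x : ℝ)) C

/-- The invariant `r₂(C)`. -/
def r₂ {n : ℕ} (C : Finset (BinHamming n)) : EReal :=
  codeMin (fun x : Fin 3 → BinHamming n => (radius x : ℝ)) C

/-- The invariant `r̄₂(C)`. -/
def rbar₂ {n : ℕ} (C : Finset (BinHamming n)) : EReal :=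
  codeMin (fun x : Fin 3 → BinHamming n => avgRadius x) C

/-! ### Hahn polynomials -/

/-- The weights `w(n,s,t;i) = C(s,i) C(n-s,t-s+i)`. -/
def hahnWeight (n s t i : ℕ) : ℕ := s.choose i * (n - s).choose (t - s + i)

/-- The bilinear form given by the weights. -/
def hahnForm (n s t : ℕ) (P Q : ℝ[X]) : ℝ :=
  ∑ i ∈ Finset.range (s + 1), (hahnWeight n s t i : ℝ) * (P.eval (i : ℝ) * Q.eval (i : ℝ))

/-- `Q` is the Hahn polynomial of degree `k` for the parameters `n, s, t`. -/
structure IsHahn (n s t k : ℕ) (Q : ℝ[X]) : Prop where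
  natDegree_eq : Q.natDegree = k
  orthogonal : ∀ P : ℝ[X], P.degree < (k : WithBot ℕ) → hahnForm n s t Q P = 0
  eval_zero : Q.eval 0 = 1

theorem hahnWeight_pos {n s t k : ℕ} (hks : k ≤ s) (hst : s ≤ t) (htk : t + k ≤ n) :
    0 < hahnWeight n s t k := by
  unfold hahnWeight
  exact Nat.mul_pos (Nat.choose_pos hks) (Nat.choose_pos (by omega))

theorem hahnForm_self {n s t k : ℕ} (hks : k ≤ s) (hst : s ≤ t) (htk : t + k ≤ n) {P : ℝ[X]}
    (hdeg : P.degree < ((k + 1 : ℕ) : WithBot ℕ)) (h : hahnForm n s t P P = 0) : P = 0 := by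
  unfold hahnForm at h
  rw [Finset.sum_eq_zero_iff_of_nonneg
    (fun i _ => mul_nonneg (Nat.cast_nonneg _) (mul_self_nonneg _))] at h
  have hz : ∀ i ∈ Finset.range (k + 1), P.eval ((i : ℕ) : ℝ) = 0 := by
    intro i hi
    have hi' : i ≤ k := by simpa [Nat.lt_succ_iff] using hi
    have h1 := h i (by simp; omega)
    have h2 : (hahnWeight n s t i : ℝ) ≠ 0 := by
      exact_mod_cast (hahnWeight_pos (hi'.trans hks) hst (by omega)).ne'
    simpa [h2] using h1
  refine Polynomial.eq_zero_of_degree_lt_of_eval_index_eq_zero (v := fun i : ℕ => (i : ℝ))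
    (s := Finset.range (k + 1)) (fun i _ j _ hij => by simpa using hij) (by simpa using hdeg) hz

theorem IsHahn.unique {n s t k : ℕ} (hks : k ≤ s) (hst : s ≤ t) (htk : t + k ≤ n) {P Q : ℝ[X]}
    (hP : IsHahn n s t k P) (hQ : IsHahn n s t k Q) : P = Q := by
  have hP0 : P ≠ 0 := by rintro rfl; simpa using hP.eval_zero
  have hQ0 : Q ≠ 0 := by rintro rfl; simpa using hQ.eval_zero
  have hp : P.leadingCoeff ≠ 0 := leadingCoeff_ne_zero.mpr hP0
  have hq : Q.leadingCoeff ≠ 0 := leadingCoeff_ne_zero.mpr hQ0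
  set D := C Q.leadingCoeff * P - C P.leadingCoeff * Q with hD
  have hdP : (C Q.leadingCoeff * P).degree = k := by
    rw [degree_C_mul hq, degree_eq_natDegree hP0, hP.natDegree_eq]
  have hdQ : (C P.leadingCoeff * Q).degree = k := by
    rw [degree_C_mul hp, degree_eq_natDegree hQ0, hQ.natDegree_eq]
  have hdeg : D.degree < (k : WithBot ℕ) := by
    rw [← hdP]
    refine degree_sub_lt_left (hdP.trans hdQ.symm) (mul_ne_zero (by simpa using hq) hP0) ?_
    simp [mul_comm]
  have hform : hahnForm n s t D D = 0 := by
    have h1 := hP.orthogonal D hdeg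
    have h2 := hQ.orthogonal D hdeg
    have : hahnForm n s t D D
        = Q.leadingCoeff * hahnForm n s t P D - P.leadingCoeff * hahnForm n s t Q D := by
      simp only [hahnForm, Finset.mul_sum, ← Finset.sum_sub_distrib]
      refine Finset.sum_congr rfl fun i _ => ?_
      have : D.eval (i : ℝ) = Q.leadingCoeff * P.eval (i : ℝ) - P.leadingCoeff * Q.eval (i : ℝ) := by
        simp [hD]
      nth_rewrite 1 [this]
      ring
    rw [this, h1, h2]; ring
  have hD0 : D = 0 := hahnForm_self hks hst htk
    (hdeg.trans (by exact_mod_cast Nat.lt_succ_self k)) hform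
  have hc : Q.leadingCoeff = P.leadingCoeff := by
    have := congrArg (eval 0) hD0
    simp only [hD, eval_sub, eval_mul, eval_C, hP.eval_zero, hQ.eval_zero, Polynomial.eval_zero] at this
    linarith
  have h3 : C P.leadingCoeff * P = C P.leadingCoeff * Q := by
    rw [hD, hc] at hD0
    exact sub_eq_zero.mp hD0
  exact mul_left_cancel₀ (by simpa using hp) h3

theorem exists_isHahn {n s t k : ℕ} (hks : k ≤ s) (hst : s ≤ t) (htk : t + k ≤ n) :
    ∃ Q : ℝ[X], IsHahn n s t k Q := by
  let φ : degreeLT ℝ (k + 1) →ₗ[ℝ] (Fin k → ℝ) :=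
    { toFun := fun P j => hahnForm n s t P.1 (X ^ (j : ℕ))
      map_add' := fun P R => by
        ext j
        simp only [hahnForm, Submodule.coe_add, eval_add, Pi.add_apply, ← Finset.sum_add_distrib]
        exact Finset.sum_congr rfl fun i _ => by ring
      map_smul' := fun r P => by
        ext j
        simp only [hahnForm, Submodule.coe_smul, eval_smul, smul_eq_mul, Pi.smul_apply,
          RingHom.id_apply, Finset.mul_sum]
        exact Finset.sum_congr rfl fun i _ => by ring }
  have hker : LinearMap.ker φ ≠ ⊥ := by
    apply LinearMap.ker_ne_bot_of_finrank_lt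
    rw [(degreeLTEquiv ℝ (k + 1)).finrank_eq]
    simp
  obtain ⟨⟨P, hPmem⟩, hPker, hPne⟩ := Submodule.exists_mem_ne_zero_of_ne_bot hker
  have hP0 : P ≠ 0 := fun h => hPne (Subtype.ext h)
  have hPdeg : P.degree < ((k + 1 : ℕ) : WithBot ℕ) := mem_degreeLT.mp hPmem
  have hX : ∀ j < k, hahnForm n s t P (X ^ j) = 0 := fun j hj =>
    congrFun (LinearMap.mem_ker.mp hPker) ⟨j, hj⟩
  have horth : ∀ R : ℝ[X], R.degree < (k : WithBot ℕ) → hahnForm n s t P R = 0 := by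
    intro R hR
    have hR' : R.natDegree < k ∨ R = 0 := by
      by_cases h : R = 0
      · exact Or.inr h
      · exact Or.inl ((natDegree_lt_iff_degree_lt h).mpr hR)
    rcases hR' with h | rfl
    · have : hahnForm n s t P R
          = ∑ j ∈ Finset.range k, R.coeff j * hahnForm n s t P (X ^ j) := by
        simp only [hahnForm, Finset.mul_sum]
        rw [Finset.sum_comm]
        refine Finset.sum_congr rfl fun i _ => ?_
        rw [eval_eq_sum_range' h, Finset.mul_sum, Finset.mul_sum]
        exact Finset.sum_congr rfl fun j _ => by simp; ring
      rw [this]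
      exact Finset.sum_eq_zero fun j hj => by rw [hX j (Finset.mem_range.mp hj), mul_zero]
    · simp [hahnForm]
  have hdeg : P.natDegree = k := by
    have h1 : P.natDegree < k + 1 := (natDegree_lt_iff_degree_lt hP0).mpr hPdeg
    by_contra hne
    have h2 : P.degree < (k : WithBot ℕ) := (natDegree_lt_iff_degree_lt hP0).mp (by omega)
    exact hP0 (hahnForm_self hks hst htk hPdeg (horth P h2))
  have hev : P.eval 0 ≠ 0 := by
    intro h0
    obtain ⟨R, rfl⟩ := (X_dvd_iff (f := P)).mpr (by rwa [coeff_zero_eq_eval_zero])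
    have hR0 : R ≠ 0 := by rintro rfl; simp at hP0
    rw [natDegree_X_mul hR0] at hdeg
    have h1 : R.degree < (k : WithBot ℕ) := (natDegree_lt_iff_degree_lt hR0).mp (by omega)
    have h2 := horth R h1
    unfold hahnForm at h2
    have hnn : ∀ i ∈ Finset.range (s + 1),
        0 ≤ (hahnWeight n s t i : ℝ) * ((X * R).eval (i : ℝ) * R.eval (i : ℝ)) := by
      intro i _
      have : (X * R).eval (i : ℝ) * R.eval (i : ℝ)
          = (i : ℝ) * (R.eval (i : ℝ) * R.eval (i : ℝ)) := by simp; ring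
      rw [this]
      exact mul_nonneg (Nat.cast_nonneg _) (mul_nonneg (Nat.cast_nonneg _) (mul_self_nonneg _))
    rw [Finset.sum_eq_zero_iff_of_nonneg hnn] at h2
    apply hR0
    refine Polynomial.eq_zero_of_degree_lt_of_eval_index_eq_zero (v := fun i : ℕ => (i : ℝ))
      (s := Finset.Icc 1 k) (fun i _ j _ hij => by simpa using hij) (by simpa using h1) ?_
    intro i hi
    obtain ⟨hi1, hik⟩ := Finset.mem_Icc.mp hi
    have h3 := h2 i (by simp; omega)
    have h4 : (hahnWeight n s t i : ℝ) ≠ 0 := by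
      exact_mod_cast (hahnWeight_pos (hik.trans hks) hst (by omega)).ne'
    have h5 : (i : ℝ) ≠ 0 := by exact_mod_cast (by omega : i ≠ 0)
    simpa [h4, h5] using h3
  refine ⟨C (P.eval 0)⁻¹ * P, ?_, ?_, ?_⟩
  · rw [natDegree_C_mul (inv_ne_zero hev), hdeg]
  · intro R hR
    have : hahnForm n s t (C (P.eval 0)⁻¹ * P) R = (P.eval 0)⁻¹ * hahnForm n s t P R := by
      simp only [hahnForm, Finset.mul_sum, eval_mul, eval_C]
      exact Finset.sum_congr rfl fun i _ => by ring
    rw [this, horth R hR, mul_zero]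
  · rw [eval_mul, eval_C, inv_mul_cancel₀ hev]

open Classical in
/-- The Hahn polynomial `Q_k(n,s,t; ·)`, for `0 ≤ s ≤ t ≤ n` and `k ≤ min(s, n-t)`
(and `0` for the parameters where there is none). -/
def hahn (n s t k : ℕ) : ℝ[X] :=
  if h : ∃ Q : ℝ[X], IsHahn n s t k Q then h.choose else 0

theorem isHahn_hahn {n s t k : ℕ} (hks : k ≤ s) (hst : s ≤ t) (htk : t + k ≤ n) :
    IsHahn n s t k (hahn n s t k) := by
  have h := exists_isHahn hks hst htk
  rw [hahn, dif_pos h]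
  exact h.choose_spec

/-- Distinct Hahn polynomials are orthogonal. -/
theorem hahnForm_hahn {n s t k l : ℕ} (hks : k ≤ s) (hst : s ≤ t) (htk : t + k ≤ n) (hlk : l < k) :
    hahnForm n s t (hahn n s t k) (hahn n s t l) = 0 := by
  refine (isHahn_hahn hks hst htk).orthogonal _ (lt_of_le_of_lt degree_le_natDegree ?_)
  rw [(isHahn_hahn (hlk.le.trans hks) hst (by omega)).natDegree_eq]
  exact_mod_cast hlk

/-! ### The matrices `T_k(a,b,c)` -/

/-- For `k ≤ s ≤ t ≤ n-k`, the value of the zonal function `E_{k,s,t}(x,y)` for words `x, y` of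
weights `s, t` whose supports meet in `m` coordinates. -/
def zonal (n k s t : ℕ) (m : ℝ) : ℝ :=
  (2 : ℝ) ^ n * (((t - k).choose (s - k) : ℝ) * ((n - 2 * k).choose (t - k) : ℝ)
    / ((n.choose t : ℝ) * (t.choose s : ℝ))) * (hahn n s t k).eval ((s : ℝ) - m)

/-- `T_k(a,b,c) = E_k(x - z, y - z)` for `d(y,z) = a`, `d(x,z) = b`, `d(x,y) = c`: the words
`x - z` and `y - z` have weights `b` and `a`, and their supports meet in `(a+b-c)/2` coordinates.
For `s > t` one uses `E_{k,s,t}(x,y) = E_{k,t,s}(y,x)`. -/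
def schrijverT (n k a b c : ℕ) :
    Matrix (Finset.Icc k (n - k)) (Finset.Icc k (n - k)) ℝ :=
  Matrix.of fun s t =>
    if s.1 = b ∧ t.1 = a then
      if s.1 ≤ t.1 then zonal n k s.1 t.1 (((a : ℝ) + b - c) / 2)
      else zonal n k t.1 s.1 (((a : ℝ) + b - c) / 2)
    else 0

/-! ### The semidefinite program -/

/-- The index set `Ω` of the unknowns. -/
def Omega (n : ℕ) : Finset (ℕ × ℕ × ℕ) :=
  (Finset.range (n + 1) ×ˢ Finset.range (n + 1) ×ˢ Finset.range (n + 1)).filter fun p =>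
    (p.1 + p.2.1 + p.2.2) % 2 = 0 ∧ p.1 + p.2.1 + p.2.2 ≤ 2 * n ∧
      p.2.2 ≤ p.1 + p.2.1 ∧ p.2.1 ≤ p.1 + p.2.2 ∧ p.1 ≤ p.2.1 + p.2.2

/-- `t(a,b,c) = C(c,i) C(n-c,a-i)` with `2i = a-b+c`, for `(a,b,c) ∈ Ω`. -/
def tCount (n a b c : ℕ) : ℕ :=
  c.choose ((a + c - b) / 2) * (n - c).choose (a - (a + c - b) / 2)

/-- Feasibility of `x = (x_{a,b,c})_{(a,b,c) ∈ Ω}`, extended by `0` outside `Ω`, for the program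
in which the triples in `I` are forbidden. -/
structure SDPFeasible (n : ℕ) (I : Set (ℕ × ℕ × ℕ)) (x : ℕ → ℕ → ℕ → ℝ) : Prop where
  support : ∀ a b c, (a, b, c) ∉ Omega n → x a b c = 0
  normalized : x 0 0 0 = 1
  nonneg : ∀ a b c, (a, b, c) ∈ Omega n → 0 ≤ x a b c
  symm : ∀ (p : Fin 3 → ℕ) (τ : Equiv.Perm (Fin 3)), (p 0, p 1, p 2) ∈ Omega n →
    x (p 0) (p 1) (p 2) = x (p (τ 0)) (p (τ 1)) (p (τ 2))
  le_c : ∀ a b c, (a, b, c) ∈ Omega n → x a b c ≤ tCount n a b c * x 0 c c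
  le_a : ∀ a b c, (a, b, c) ∈ Omega n → x a b c ≤ tCount n b c a * x 0 a a
  le_b : ∀ a b c, (a, b, c) ∈ Omega n → x a b c ≤ tCount n c a b * x 0 b b
  psd : ∀ k ≤ n / 2,
    (∑ p ∈ Omega n, x p.1 p.2.1 p.2.2 • schrijverT n k p.1 p.2.1 p.2.2).PosSemidef
  psd_compl : ∀ k ≤ n / 2,
    (∑ p ∈ Omega n, ((tCount n p.1 p.2.1 p.2.2 : ℝ) * x 0 p.2.2 p.2.2 - x p.1 p.2.1 p.2.2) •
      schrijverT n k p.1 p.2.1 p.2.2).PosSemidef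
  vanish : ∀ a b c, (a, b, c) ∈ Omega n → (a, b, c) ∈ I → x a b c = 0

/-- The objective function `∑_c x_{0,c,c}`. -/
def sdpObjective (n : ℕ) (x : ℕ → ℕ → ℕ → ℝ) : ℝ :=
  ∑ c ∈ Finset.range (n + 1), x 0 c c

/-- The objective values of the feasible points. -/
def sdpValues (n : ℕ) (I : Set (ℕ × ℕ × ℕ)) : Set ℝ :=
  sdpObjective n '' {x | SDPFeasible n I x}

/-- The optimal value of the program. -/
def sdpOptimum (n : ℕ) (I : Set (ℕ × ℕ × ℕ)) : ℝ := sSup (sdpValues n I)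

/-- The forbidden triples for `d₂(C) ≥ d`. -/
def forbidD (d : ℕ) : Set (ℕ × ℕ × ℕ) :=
  {p | p.1 * p.2.1 * p.2.2 ≠ 0 ∧ (p.1 : ℤ) + p.2.1 + p.2.2 ≤ 2 * ((d : ℤ) - 1)}

/-- The forbidden triples for `r₂(C) ≥ r`. -/
def forbidR (r : ℕ) : Set (ℕ × ℕ × ℕ) :=
  {p | p.1 * p.2.1 * p.2.2 ≠ 0 ∧
    max (max ⌈(p.1 : ℝ) / 2⌉ ⌈(p.2.1 : ℝ) / 2⌉) ⌈(p.2.2 : ℝ) / 2⌉ ≤ (r : ℤ) - 1}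

/-- The forbidden triples for `r̄₂(C) ≥ ρ`. -/
def forbidRbar (ρ : ℝ) : Set (ℕ × ℕ × ℕ) :=
  {p | p.1 * p.2.1 * p.2.2 ≠ 0 ∧ (p.1 : ℝ) + p.2.1 + p.2.2 < 6 * ρ}

/-- The triple-distance distribution of a code: `x_{a,b,c}` is the number of `(x,y,z) ∈ C³` with
`d(y,z) = a`, `d(x,z) = b`, `d(x,y) = c`, divided by `|C|`. -/
def tripleDistribution {n : ℕ} (C : Finset (BinHamming n)) (a b c : ℕ) : ℝ :=
  (1 / (C.card : ℝ)) * (((C ×ˢ C ×ˢ C).filter fun p =>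
    hammingDist p.2.1 p.2.2 = a ∧ hammingDist p.1 p.2.2 = b ∧ hammingDist p.1 p.2.1 = c).card : ℝ)

end

/-!
The operator `hahnRaise` is adjoint, for the weights of two neighbouring parameter sets, to a
difference operator. It therefore raises orthogonal polynomials to orthogonal polynomials of one
degree more, and `k` applications to the constant `1` give the Hahn polynomial of degree `k` up to a
positive factor. On subsets of a finite set `V` the recursion becomes a formula for kernels: the
kernel of degree `k + 1` on `V` is half the sum, over all `a, b ∈ V`, of the kernel of degree `k` on
`V \ {a, b}` multiplied on both sides by the sign with which a subset separates `a` from `b`. By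
induction all these kernels are positive semidefinite.

Fix a word `z`. Up to a positive factor, the matrix `T_k` of the distances of `(x, y, z)` carries
the value of the kernel at the difference sets of `x, z` and of `y, z`, so its sum over `x, y ∈ C`
is positive semidefinite. Adding over `z ∈ C` gives (vii), and adding over `z ∉ C` gives (viii),
because `t(a,b,c)` counts all the words `z` at distances `a, b` from two words at distance `c`.
Conditions (ix) hold because three binary words have a median, which lies on geodesics between any
two of them, and the maximum exists because the feasible region is compact.
-/

/-! ### Hahn polynomials by a raising recursion -/

section RaisingRecursion

open Polynomial

section CommRing

variable {R : Type*} [CommRing R]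

theorem degree_C_mul_lt {P : R[X]} {d : WithBot ℕ} (hP : P.degree < d) (r : R) :
    (C r * P).degree < d := by
  rw [← smul_eq_C_mul]
  exact (degree_smul_le r P).trans_lt hP

theorem degree_X_pow_mul_lt {P : R[X]} {d : ℕ} (hP : P.degree < d) (j : ℕ) :
    (X ^ j * P).degree < ((d + j : ℕ) : WithBot ℕ) := by
  rw [degree_lt_iff_coeff_zero] at *
  intro m hm
  rw [coeff_X_pow_mul', if_pos (by omega)]
  exact hP _ (by omega)

theorem degree_sub_taylor_lt {P : R[X]} {d : ℕ} (hP : P.degree < ((d + 1 : ℕ) : WithBot ℕ))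
    (r : R) : (P - taylor r P).degree < d := by
  rcases eq_or_ne P 0 with rfl | h0
  · simp
  · have hle : P.degree ≤ d :=
      degree_le_of_natDegree_le (Nat.lt_succ_iff.mp ((natDegree_lt_iff_degree_lt h0).mpr hP))
    exact (degree_sub_lt_left (degree_taylor P r).symm h0 (leadingCoeff_taylor r P).symm).trans_le
      hle

/-- The operator raising orthogonal polynomials for the weights `hahnWeight (n - 2) (s - 1) (t - 1)`
to orthogonal polynomials, of one degree more, for the weights `hahnWeight n s t`; the parameters
range over a ring so that they may be decreased without truncation. -/
noncomputable def hahnRaise (n s t : R) (P : R[X]) : R[X] :=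
  (C s - X) * (C (n - t) - X) * P - X * (X + C (t - s)) * taylor (-1) P

/-- The Hahn polynomial of degree `k`, not normalized at `0`. -/
noncomputable def rawHahn : ℕ → R → R → R → R[X]
  | 0, _, _, _ => 1
  | k + 1, n, s, t => hahnRaise n s t (rawHahn k (n - 2) (s - 1) (t - 1))

theorem eval_hahnRaise (n s t z : R) (P : R[X]) :
    (hahnRaise n s t P).eval z
      = (s - z) * (n - t - z) * P.eval z - z * (z + (t - s)) * P.eval (z - 1) := by
  simp [hahnRaise, taylor_eval, ← sub_eq_add_neg]

theorem degree_hahnRaise_lt (n s t : R) {P : R[X]} {d : ℕ}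
    (hP : P.degree < ((d + 1 : ℕ) : WithBot ℕ)) :
    (hahnRaise n s t P).degree < ((d + 2 : ℕ) : WithBot ℕ) := by
  -- The terms of order `X ^ 2` combine into `X ^ 2 * (P - taylor (-1) P)`.
  have expand : hahnRaise n s t P = C (s * (n - t)) * P + C (-(s + n - t)) * (X ^ 1 * P)
      + X ^ 2 * (P - taylor (-1) P) + C (-(t - s)) * (X ^ 1 * taylor (-1) P) := by
    simp only [hahnRaise, C_mul, C_sub, C_neg, C_add]
    ring
  have hτ : (taylor (-1) P).degree < ((d + 1 : ℕ) : WithBot ℕ) := by rwa [degree_taylor]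
  rw [expand, ← mem_degreeLT]
  refine add_mem (add_mem (add_mem ?_ ?_) ?_) ?_ <;> rw [mem_degreeLT]
  · exact degree_C_mul_lt (hP.trans (by exact_mod_cast Nat.lt_succ_self _)) _
  · exact degree_C_mul_lt (degree_X_pow_mul_lt hP 1) _
  · exact degree_X_pow_mul_lt (degree_sub_taylor_lt hP _) 2
  · exact degree_C_mul_lt (degree_X_pow_mul_lt hτ 1) _

theorem degree_rawHahn_lt (k : ℕ) (n s t : R) :
    (rawHahn k n s t).degree < ((k + 1 : ℕ) : WithBot ℕ) := by
  induction k generalizing n s t with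
  | zero => exact degree_one_le.trans_lt (by simp)
  | succ k ih => exact degree_hahnRaise_lt n s t (ih _ _ _)

theorem eval_zero_rawHahn (k : ℕ) (n s t : R) :
    (rawHahn k n s t).eval 0 = (descPochhammer R k).eval s * (descPochhammer R k).eval (n - t) := by
  induction k generalizing n s t with
  | zero => simp [rawHahn]
  | succ k ih =>
    rw [rawHahn, eval_hahnRaise, ih, show n - 2 - (t - 1) = n - t - 1 by ring]
    simp only [descPochhammer_succ_left, eval_mul, eval_X, eval_comp, eval_sub, eval_one]
    ring

theorem eval_rawHahn_comm (k : ℕ) (n s t m : R) :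
    (rawHahn k n s t).eval (s - m) = (rawHahn k n t s).eval (t - m) := by
  induction k generalizing n s t m with
  | zero => simp [rawHahn]
  | succ k ih =>
    have hm := ih (n - 2) (s - 1) (t - 1) m
    have hm' := ih (n - 2) (s - 1) (t - 1) (m - 1)
    rw [sub_sub_sub_cancel_right, sub_sub_sub_cancel_right] at hm'
    rw [sub_right_comm s, sub_right_comm t] at hm
    simp only [rawHahn, eval_hahnRaise, hm, hm']
    ring

end CommRing

variable {n s t k : ℕ}

theorem cast_succ_choose_mul (a j : ℕ) :
    ((a + 1).choose j : ℝ) * (a + 1 - j) = (a + 1) * a.choose j := by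
  rcases le_or_gt j (a + 1) with hj | hj
  · rw [← Nat.cast_add_one, ← Nat.cast_sub hj, ← Nat.cast_mul, ← Nat.choose_mul_succ_eq,
      Nat.cast_mul, mul_comm]
  · rw [Nat.choose_eq_zero_of_lt hj, Nat.choose_eq_zero_of_lt (by omega : a < j)]
    simp

theorem hahnWeight_succ_mul_left (hst : s ≤ t) (htn : t ≤ n) (i : ℕ) :
    (hahnWeight (n + 2) (s + 1) (t + 1) i : ℝ) * ((s + 1 - i) * (n + 2 - (t + 1) - i))
      = (s + 1) * (n - s + 1) * hahnWeight n s t i := by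
  obtain ⟨u, rfl⟩ := Nat.exists_eq_add_of_le hst
  obtain ⟨v, rfl⟩ := Nat.exists_eq_add_of_le htn
  have hs := cast_succ_choose_mul s i
  have hu := cast_succ_choose_mul (u + v) (u + i)
  rw [hahnWeight, hahnWeight, show s + u + v + 2 - (s + 1) = u + v + 1 by omega,
    show s + u + 1 - (s + 1) + i = u + i by omega, show s + u + v - s = u + v by omega,
    show s + u - s + i = u + i by omega]
  push_cast at hu ⊢
  linear_combination ((u + v + 1).choose (u + i) : ℝ) * (v + 1 - i) * hs
    + (s + 1) * (s.choose i : ℝ) * hu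

theorem hahnWeight_succ_mul_right (hst : s ≤ t) (htn : t ≤ n) (i : ℕ) :
    (hahnWeight (n + 2) (s + 1) (t + 1) (i + 1) : ℝ) * ((i + 1) * (i + 1 + (t - s)))
      = (s + 1) * (n - s + 1) * hahnWeight n s t i := by
  obtain ⟨u, rfl⟩ := Nat.exists_eq_add_of_le hst
  obtain ⟨v, rfl⟩ := Nat.exists_eq_add_of_le htn
  have hs : ((s : ℝ) + 1) * s.choose i = (s + 1).choose (i + 1) * (i + 1) := by
    exact_mod_cast Nat.add_one_mul_choose_eq s i
  have hu : ((u : ℝ) + v + 1) * (u + v).choose (u + i)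
      = (u + v + 1).choose (u + i + 1) * (u + i + 1) := by
    exact_mod_cast Nat.add_one_mul_choose_eq (u + v) (u + i)
  rw [hahnWeight, hahnWeight, show s + u + v + 2 - (s + 1) = u + v + 1 by omega,
    show s + u + 1 - (s + 1) + (i + 1) = u + i + 1 by omega,
    show s + u + v - s = u + v by omega, show s + u - s + i = u + i by omega]
  push_cast
  linear_combination -((u + v + 1).choose (u + i + 1) : ℝ) * (u + i + 1) * hs
    - (s + 1) * (s.choose i : ℝ) * hu

theorem hahnForm_C_mul_left (n s t : ℕ) (r : ℝ) (P Q : ℝ[X]) :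
    hahnForm n s t (C r * P) Q = r * hahnForm n s t P Q := by
  simp only [hahnForm, Finset.mul_sum, eval_mul, eval_C]
  exact Finset.sum_congr rfl fun i _ => by ring

/-- Summation by parts. -/
theorem hahnForm_hahnRaise (hst : s ≤ t) (htn : t ≤ n) (P Q : ℝ[X]) :
    hahnForm (n + 2) (s + 1) (t + 1) (hahnRaise (n + 2) (s + 1) (t + 1) P) Q
      = (s + 1) * (n - s + 1) * hahnForm n s t P (Q - taylor 1 Q) := by
  set c : ℝ := (s + 1) * (n - s + 1)
  set w : ℕ → ℝ := fun i => hahnWeight n s t i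
  set w' : ℕ → ℝ := fun i => hahnWeight (n + 2) (s + 1) (t + 1) i
  set f : ℕ → ℝ := fun i => w' i * ((s + 1 - i) * (n + 2 - (t + 1) - i)) * (P.eval ↑i * Q.eval ↑i)
  set g : ℕ → ℝ := fun i => w' i * (i * (i + (t - s))) * (P.eval (i - 1 : ℝ) * Q.eval ↑i)
  have hf (i : ℕ) : f i = c * w i * (P.eval ↑i * Q.eval ↑i) := by
    rw [← hahnWeight_succ_mul_left hst htn]
  have hf_last : f (s + 1) = 0 := by simp [f]
  have hg (i : ℕ) : g (i + 1) = c * w i * (P.eval ↑i * Q.eval (i + 1 : ℝ)) := by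
    rw [← hahnWeight_succ_mul_right hst htn]
    simp [g, w']
  have hg_zero : g 0 = 0 := by simp [g]
  calc hahnForm (n + 2) (s + 1) (t + 1) (hahnRaise (n + 2) (s + 1) (t + 1) P) Q
      = ∑ i ∈ Finset.range (s + 1 + 1), (f i - g i) :=
        Finset.sum_congr rfl fun i _ => by simp only [eval_hahnRaise, f, g, w']; ring
    _ = ∑ i ∈ Finset.range (s + 1), (f i - g (i + 1)) := by
        rw [Finset.sum_sub_distrib, Finset.sum_range_succ f, Finset.sum_range_succ' g, hf_last,
          hg_zero, add_zero, add_zero, Finset.sum_sub_distrib]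
    _ = c * hahnForm n s t P (Q - taylor 1 Q) := by
        rw [hahnForm, Finset.mul_sum]
        refine Finset.sum_congr rfl fun i _ => ?_
        rw [hf, hg, eval_sub, taylor_eval]
        ring

theorem hahnForm_rawHahn_eq_zero (hks : k ≤ s) (hst : s ≤ t) (htk : t + k ≤ n) {Q : ℝ[X]}
    (hQ : Q.degree < k) : hahnForm n s t (rawHahn k n s t) Q = 0 := by
  induction k generalizing n s t Q with
  | zero =>
    have : Q = 0 := degree_eq_bot.mp (Nat.WithBot.lt_zero_iff.mp hQ)
    simp [this, hahnForm]
  | succ k ih =>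
    obtain ⟨s, rfl⟩ := Nat.exists_eq_add_of_le' (by omega : 1 ≤ s)
    obtain ⟨t, rfl⟩ := Nat.exists_eq_add_of_le' (by omega : 1 ≤ t)
    obtain ⟨n, rfl⟩ := Nat.exists_eq_add_of_le' (by omega : 2 ≤ n)
    push_cast
    rw [rawHahn, hahnForm_hahnRaise (by omega) (by omega)]
    simp only [add_sub_cancel_right]
    rw [ih (by omega) (by omega) (by omega) (degree_sub_taylor_lt hQ 1), mul_zero]

theorem isHahn_C_inv_mul (hks : k ≤ s) (hst : s ≤ t) (htk : t + k ≤ n) {P : ℝ[X]}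
    (hdeg : P.degree < ((k + 1 : ℕ) : WithBot ℕ))
    (horth : ∀ Q : ℝ[X], Q.degree < k → hahnForm n s t P Q = 0) (h0 : P.eval 0 ≠ 0) :
    IsHahn n s t k (C (P.eval 0)⁻¹ * P) where
  natDegree_eq := by
    have hP : P ≠ 0 := by rintro rfl; exact h0 Polynomial.eval_zero
    rw [natDegree_C_mul (inv_ne_zero h0)]
    refine (Nat.lt_succ_iff.mp ((natDegree_lt_iff_degree_lt hP).mpr hdeg)).eq_of_not_lt
      fun hlt => ?_
    exact hP (hahnForm_self hks hst htk hdeg (horth P ((natDegree_lt_iff_degree_lt hP).mp hlt)))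
  orthogonal Q hQ := by rw [hahnForm_C_mul_left, horth Q hQ, mul_zero]
  eval_zero := by rw [eval_mul, eval_C, inv_mul_cancel₀ h0]

theorem hahn_eq_rawHahn (hks : k ≤ s) (hst : s ≤ t) (htk : t + k ≤ n) :
    hahn n s t k
      = C (s.descFactorial k * (n - t).descFactorial k : ℝ)⁻¹ * rawHahn k (n : ℝ) s t := by
  have h0 : (rawHahn k (n : ℝ) s t).eval 0 = s.descFactorial k * (n - t).descFactorial k := by
    rw [eval_zero_rawHahn, ← Nat.cast_sub (by omega : t ≤ n), descPochhammer_eval_eq_descFactorial,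
      descPochhammer_eval_eq_descFactorial]
  rw [← h0]
  refine (isHahn_hahn hks hst htk).unique hks hst htk (isHahn_C_inv_mul hks hst htk
    (degree_rawHahn_lt _ _ _ _) (fun Q => hahnForm_rawHahn_eq_zero hks hst htk) ?_)
  rw [h0]
  have hs := Nat.descFactorial_pos.mpr hks
  have ht := Nat.descFactorial_pos.mpr (by omega : k ≤ n - t)
  positivity

theorem choose_ratio_eq_descFactorial (hks : k ≤ s) (hst : s ≤ t) (htk : t + k ≤ n) :
    ((t - k).choose (s - k) : ℝ) * (n - 2 * k).choose (t - k) / (n.choose t * t.choose s)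
      = ((n - 2 * k).factorial / n.factorial)
        * (s.descFactorial k * (n - t).descFactorial k) := by
  obtain ⟨s, rfl⟩ := Nat.exists_eq_add_of_le' hks
  obtain ⟨u, rfl⟩ := Nat.exists_eq_add_of_le hst
  obtain ⟨v, rfl⟩ := Nat.exists_eq_add_of_le htk
  have descFactorial_eq (a : ℕ) :
      ((a + k).descFactorial k : ℝ) = (a + k).factorial / a.factorial := by
    rw [eq_div_iff (by positivity), mul_comm]
    simpa using congrArg (Nat.cast (R := ℝ))
      (Nat.factorial_mul_descFactorial (Nat.le_add_left k a))
  rw [show s + k + u - k = s + u by omega, Nat.add_sub_cancel,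
    show s + k + u + k + v - 2 * k = s + u + v by omega,
    show s + k + u + k + v - (s + k + u) = v + k by omega,
    show s + k + u + k + v = s + k + u + (v + k) by omega]
  simp only [Nat.cast_add_choose, descFactorial_eq]
  field_simp

/-- The positive factor relating `zonal n k` to the kernel of `rawHahn k`. -/
noncomputable def zonalFactor (n k : ℕ) : ℝ := 2 ^ n * ((n - 2 * k).factorial / n.factorial)

theorem zonalFactor_nonneg (n k : ℕ) : 0 ≤ zonalFactor n k := by
  unfold zonalFactor
  positivity

theorem zonal_eq_rawHahn (hks : k ≤ s) (hst : s ≤ t) (htk : t + k ≤ n) (m : ℝ) :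
    zonal n k s t m = zonalFactor n k * (rawHahn k (n : ℝ) s t).eval (s - m) := by
  have hs := Nat.descFactorial_pos.mpr hks
  have ht := Nat.descFactorial_pos.mpr (by omega : k ≤ n - t)
  rw [zonal, hahn_eq_rawHahn hks hst htk, choose_ratio_eq_descFactorial hks hst htk, eval_mul,
    eval_C, zonalFactor]
  field_simp

end RaisingRecursion

/-! ### The kernels of the Hahn polynomials -/

section Kernel

open Finset Matrix Polynomial

variable {α : Type*} [DecidableEq α]

/-- The kernel of the unnormalized Hahn polynomial of degree `k` on the subsets of `V`, invariant
under the permutations of `V`; its value depends on `#V`, `#x`, `#y` and `#(x ∩ y)` only. -/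
noncomputable def hahnKernel (k : ℕ) (V x y : Finset α) : ℝ :=
  (rawHahn k (#V : ℝ) #x #y).eval (#x - #(x ∩ y) : ℝ)

theorem hahnKernel_comm (k : ℕ) (V x y : Finset α) : hahnKernel k V x y = hahnKernel k V y x := by
  rw [hahnKernel, hahnKernel, inter_comm y, eval_rawHahn_comm]

/-- The indicator function of `S`. -/
noncomputable def finsetIndicator (S : Finset α) (a : α) : ℝ := if a ∈ S then 1 else 0

theorem sum_finsetIndicator {V S : Finset α} (h : S ⊆ V) :
    ∑ a ∈ V, finsetIndicator S a = #S := by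
  simp [finsetIndicator, inter_eq_right.mpr h]

theorem cast_card_erase (S : Finset α) (a : α) :
    (#(S.erase a) : ℝ) = #S - finsetIndicator S a := by
  unfold finsetIndicator
  split_ifs with h
  · exact cast_card_erase_of_mem h
  · rw [erase_eq_of_notMem h, sub_zero]

theorem cast_card_sdiff_pair (S : Finset α) {a b : α} (hab : a ≠ b) :
    (#(S \ {a, b}) : ℝ) = #S - finsetIndicator S a - finsetIndicator S b := by
  rw [sdiff_insert, sdiff_singleton_eq_erase, cast_card_erase, cast_card_erase]
  rw [show finsetIndicator (S.erase b) a = finsetIndicator S a by simp [finsetIndicator, hab],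
    sub_right_comm]

theorem hahnKernel_sdiff_pair (k : ℕ) {V : Finset α} (x y : Finset α) {a b : α} (ha : a ∈ V)
    (hb : b ∈ V) (hab : a ≠ b) :
    hahnKernel k (V \ {a, b}) (x \ {a, b}) (y \ {a, b})
      = (rawHahn k (#V - 2 : ℝ) (#x - finsetIndicator x a - finsetIndicator x b)
          (#y - finsetIndicator y a - finsetIndicator y b)).eval
        (#x - finsetIndicator x a - finsetIndicator x b
          - (#(x ∩ y) - finsetIndicator (x ∩ y) a - finsetIndicator (x ∩ y) b)) := by
  have hV : finsetIndicator V a = 1 ∧ finsetIndicator V b = 1 := by simp [finsetIndicator, ha, hb]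
  have hinter : x \ {a, b} ∩ (y \ {a, b}) = (x ∩ y) \ {a, b} := inf_sdiff.symm
  simp only [hahnKernel, hinter, cast_card_sdiff_pair _ hab, hV, sub_sub,
    one_add_one_eq_two]

/-- The summand does not vanish only when each of `x` and `y` separates `a` from `b`: they do so
either on the same side, or on opposite sides. -/
theorem finsetIndicator_sub_mul_hahnKernel (k : ℕ) {V : Finset α} (x y : Finset α) {a b : α}
    (ha : a ∈ V) (hb : b ∈ V) :
    (finsetIndicator x a - finsetIndicator x b) * (finsetIndicator y a - finsetIndicator y b)
        * hahnKernel k (V \ {a, b}) (x \ {a, b}) (y \ {a, b})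
      = (rawHahn k (#V - 2 : ℝ) (#x - 1) (#y - 1)).eval (#x - #(x ∩ y) : ℝ)
          * (finsetIndicator (x ∩ y) a * finsetIndicator (V \ (x ∪ y)) b
            + finsetIndicator (V \ (x ∪ y)) a * finsetIndicator (x ∩ y) b)
        - (rawHahn k (#V - 2 : ℝ) (#x - 1) (#y - 1)).eval (#x - #(x ∩ y) - 1 : ℝ)
          * (finsetIndicator (x \ y) a * finsetIndicator (y \ x) b
            + finsetIndicator (y \ x) a * finsetIndicator (x \ y) b) := by
  rcases eq_or_ne a b with rfl | hab
  · by_cases hxa : a ∈ x <;> by_cases hya : a ∈ y <;> simp [finsetIndicator, hxa, hya]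
  rw [hahnKernel_sdiff_pair k x y ha hb hab]
  by_cases hxa : a ∈ x <;> by_cases hxb : b ∈ x <;> by_cases hya : a ∈ y <;>
    by_cases hyb : b ∈ y <;>
    simp [finsetIndicator, ha, hb, hxa, hxb, hya, hyb, sub_right_comm (#x : ℝ) 1 #(x ∩ y)]

theorem two_mul_hahnKernel_succ (k : ℕ) {V x y : Finset α} (hx : x ⊆ V) (hy : y ⊆ V) :
    2 * hahnKernel (k + 1) V x y = ∑ a ∈ V, ∑ b ∈ V,
      (finsetIndicator x a - finsetIndicator x b) * (finsetIndicator y a - finsetIndicator y b)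
        * hahnKernel k (V \ {a, b}) (x \ {a, b}) (y \ {a, b}) := by
  have hinter : ∑ a ∈ V, finsetIndicator (x ∩ y) a = #(x ∩ y) :=
    sum_finsetIndicator (inter_subset_left.trans hx)
  have hx_sdiff : ∑ a ∈ V, finsetIndicator (x \ y) a = #x - #(x ∩ y) := by
    rw [sum_finsetIndicator (sdiff_subset.trans hx), ← sdiff_inter_self_left,
      cast_card_sdiff inter_subset_left]
  have hy_sdiff : ∑ a ∈ V, finsetIndicator (y \ x) a = #y - #(x ∩ y) := by
    rw [sum_finsetIndicator (sdiff_subset.trans hy), ← sdiff_inter_self_right,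
      cast_card_sdiff inter_subset_right]
  have houter : ∑ a ∈ V, finsetIndicator (V \ (x ∪ y)) a = #V - #x - #y + #(x ∩ y) := by
    rw [sum_finsetIndicator sdiff_subset, cast_card_sdiff (union_subset hx hy), cast_card_union]
    ring
  rw [sum_congr rfl fun a ha => sum_congr rfl fun b hb =>
    finsetIndicator_sub_mul_hahnKernel k x y ha hb]
  simp only [sum_sub_distrib, ← mul_sum, sum_add_distrib, ← sum_mul, hinter, hx_sdiff, hy_sdiff,
    houter, hahnKernel, rawHahn, eval_hahnRaise]
  ring

theorem posSemidef_hahnKernel {ι : Type*} [Finite ι] (k : ℕ) {V : Finset α}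
    {x : ι → Finset α} (hx : ∀ i, x i ⊆ V) :
    (Matrix.of fun i j => hahnKernel k V (x i) (x j)).PosSemidef := by
  classical
  cases nonempty_fintype ι
  induction k generalizing V x with
  | zero =>
    convert posSemidef_vecMulVec_self_star (1 : ι → ℝ) using 1
    ext i j
    simp [hahnKernel, rawHahn, vecMulVec]
  | succ k ih =>
    let D (a b : α) : Matrix ι ι ℝ :=
      diagonal fun i => finsetIndicator (x i) a - finsetIndicator (x i) b
    let K (a b : α) : Matrix ι ι ℝ :=
      Matrix.of fun i j => hahnKernel k (V \ {a, b}) (x i \ {a, b}) (x j \ {a, b})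
    have hsum : (Matrix.of fun i j => hahnKernel (k + 1) V (x i) (x j))
        = (2⁻¹ : ℝ) • ∑ a ∈ V, ∑ b ∈ V, D a b * K a b * (D a b)ᴴ := by
      ext i j
      rw [of_apply, ← inv_mul_cancel_left₀ (two_ne_zero (α := ℝ)) (hahnKernel _ _ _ _),
        two_mul_hahnKernel_succ k (hx i) (hx j)]
      simp [D, K, Matrix.sum_apply, mul_right_comm]
    rw [hsum]
    exact (posSemidef_sum _ fun a _ => posSemidef_sum _ fun b _ =>
      (ih fun i => sdiff_subset_sdiff (hx i) subset_rfl).mul_mul_conjTranspose_same _).smul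
        (by positivity)

end Kernel

/-! ### Triples of words -/

section Triples

open Finset

variable {n : ℕ}

/-- The set of the coordinates in which two words differ. -/
def diffSet (x y : BinHamming n) : Finset (Fin n) := {j | x j ≠ y j}

theorem card_diffSet (x y : BinHamming n) : #(diffSet x y) = hammingDist x y := rfl

theorem diffSet_eq_symmDiff (x y z : BinHamming n) :
    diffSet x y = symmDiff (diffSet x z) (diffSet y z) := by
  ext j
  simp only [diffSet, mem_symmDiff, mem_filter_univ, not_not]
  generalize x j = u, y j = v, z j = w
  revert u v w
  decide

theorem diffSet_left_bijective (y : BinHamming n) :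
    Function.Bijective fun x : BinHamming n => diffSet x y := by
  rw [Fintype.bijective_iff_injective_and_card]
  refine ⟨fun x z hxz => ?_, by simp⟩
  rw [← hammingDist_eq_zero, ← card_diffSet, diffSet_eq_symmDiff x z y,
    show diffSet x y = _ from hxz, symmDiff_self, bot_eq_empty, card_empty]

theorem hammingDist_add_two_mul_card_inter (x y z : BinHamming n) :
    hammingDist x y + 2 * #(diffSet x z ∩ diffSet y z) = hammingDist x z + hammingDist y z := by
  have hx := card_sdiff_add_card_inter (diffSet x z) (diffSet y z)
  have hy := card_sdiff_add_card_inter (diffSet y z) (diffSet x z)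
  have hxy : hammingDist x y
      = #(diffSet x z \ diffSet y z) + #(diffSet y z \ diffSet x z) := by
    rw [← card_diffSet, diffSet_eq_symmDiff x y z]
    exact card_union_of_disjoint disjoint_sdiff_sdiff
  rw [inter_comm] at hy
  rw [card_diffSet] at hx hy
  omega

/-- The triple `(a, b, c)` of distances recorded by the unknown `x_{a,b,c}`: each distance stands at
the position of the word it does not involve. -/
def distTriple (x y z : BinHamming n) : ℕ × ℕ × ℕ :=
  (hammingDist y z, hammingDist x z, hammingDist x y)

theorem distTriple_mem_Omega (x y z : BinHamming n) : distTriple x y z ∈ Omega n := by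
  have hle (u v : BinHamming n) : hammingDist u v ≤ n := by
    simpa using hammingDist_le_card_fintype (x := u) (y := v)
  have hinter := hammingDist_add_two_mul_card_inter x y z
  have hunion := card_union_add_card_inter (diffSet x z) (diffSet y z)
  have hunion_le : #(diffSet x z ∪ diffSet y z) ≤ n := card_finset_fin_le _
  have hxy := hle x y
  have hxz := hle x z
  have hyz := hle y z
  have htri := hammingDist_triangle x y z
  have htri' := hammingDist_triangle y x z
  rw [hammingDist_comm y x] at htri'
  rw [card_diffSet, card_diffSet] at hunion
  simp only [distTriple, Omega, mem_filter, mem_product, mem_range]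
  omega

theorem zonal_card_inter {s t k : ℕ} {x y : Finset (Fin n)} (hx : #x = s) (hy : #y = t)
    (hks : k ≤ s) (hst : s ≤ t) (htk : t + k ≤ n) :
    zonal n k s t #(x ∩ y) = zonalFactor n k * hahnKernel k univ x y := by
  rw [zonal_eq_rawHahn hks hst htk, hahnKernel, hx, hy, card_univ, Fintype.card_fin]

theorem schrijverT_hammingDist (k : ℕ) (x y z : BinHamming n) (s t : Icc k (n - k)) :
    schrijverT n k (hammingDist y z) (hammingDist x z) (hammingDist x y) s t
      = if s.1 = hammingDist x z ∧ t.1 = hammingDist y z then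
          zonalFactor n k * hahnKernel k univ (diffSet x z) (diffSet y z) else 0 := by
  have hinter : ((hammingDist y z : ℝ) + hammingDist x z - hammingDist x y) / 2
      = #(diffSet x z ∩ diffSet y z) := by
    have : (hammingDist x y : ℝ) + 2 * #(diffSet x z ∩ diffSet y z)
        = hammingDist x z + hammingDist y z := by
      exact_mod_cast hammingDist_add_two_mul_card_inter x y z
    linarith
  obtain ⟨hks, hsn⟩ := mem_Icc.mp s.2
  obtain ⟨hkt, htn⟩ := mem_Icc.mp t.2
  rw [schrijverT, Matrix.of_apply, hinter]
  refine if_ctx_congr Iff.rfl (fun h => ?_) fun _ => rfl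
  have hx : #(diffSet x z) = s.1 := h.1.symm
  have hy : #(diffSet y z) = t.1 := h.2.symm
  split_ifs with hst
  · exact zonal_card_inter hx hy hks hst (by omega)
  · rw [inter_comm, hahnKernel_comm, zonal_card_inter hy hx hkt (by omega) (by omega)]

theorem posSemidef_sum_schrijverT (k : ℕ) (C : Finset (BinHamming n)) (z : BinHamming n) :
    (∑ x ∈ C, ∑ y ∈ C,
      schrijverT n k (hammingDist y z) (hammingDist x z) (hammingDist x y)).PosSemidef := by
  let B : Matrix (Icc k (n - k)) C ℝ :=
    Matrix.of fun s x => if s.1 = hammingDist x.1 z then 1 else 0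
  let K : Matrix C C ℝ := Matrix.of fun x y => hahnKernel k univ (diffSet x.1 z) (diffSet y.1 z)
  have hsum : ∑ x ∈ C, ∑ y ∈ C,
      schrijverT n k (hammingDist y z) (hammingDist x z) (hammingDist x y)
      = zonalFactor n k • (B * K * B.conjTranspose) := by
    ext s t
    simp only [Matrix.sum_apply, schrijverT_hammingDist, Matrix.smul_apply, Matrix.mul_apply,
      smul_eq_mul, sum_mul, mul_sum]
    rw [sum_comm, ← sum_coe_sort C]
    refine sum_congr rfl fun y _ => ?_
    rw [← sum_coe_sort C]
    refine sum_congr rfl fun x _ => ?_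
    simp [B, K, ← ite_and, and_comm]
  rw [hsum]
  exact ((posSemidef_hahnKernel k fun _ => subset_univ _).mul_mul_conjTranspose_same B).smul
    (zonalFactor_nonneg n k)

/-- The number of triples `(x, y, z) ∈ C × C × Z` with the distances `p`. The set `Z` is the code
`C` or its complement, the two cases giving the two families of positive semidefinite matrices. -/
def tripleCount (C Z : Finset (BinHamming n)) (p : ℕ × ℕ × ℕ) : ℕ :=
  #{q ∈ C ×ˢ C ×ˢ Z | distTriple q.1 q.2.1 q.2.2 = p}

theorem sum_tripleCount_nsmul {M : Type*} [AddCommMonoid M] (C Z : Finset (BinHamming n))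
    (f : ℕ × ℕ × ℕ → M) :
    ∑ p ∈ Omega n, tripleCount C Z p • f p
      = ∑ z ∈ Z, ∑ x ∈ C, ∑ y ∈ C, f (distTriple x y z) := by
  simp only [tripleCount, ← sum_const]
  rw [sum_fiberwise_of_maps_to' (fun q _ => distTriple_mem_Omega q.1 q.2.1 q.2.2) f]
  simp only [sum_product]
  rw [sum_congr rfl fun x _ => sum_comm, sum_comm]

theorem posSemidef_sum_tripleCount_smul (k : ℕ) (C Z : Finset (BinHamming n)) :
    (∑ p ∈ Omega n,
      (tripleCount C Z p : ℝ) • schrijverT n k p.1 p.2.1 p.2.2).PosSemidef := by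
  simp only [Nat.cast_smul_eq_nsmul]
  rw [sum_tripleCount_nsmul C Z fun p => schrijverT n k p.1 p.2.1 p.2.2]
  exact Matrix.posSemidef_sum _ fun z _ => posSemidef_sum_schrijverT k C z

theorem tripleCount_swap_left (C Z : Finset (BinHamming n)) (a b c : ℕ) :
    tripleCount C Z (a, b, c) = tripleCount C Z (b, a, c) := by
  refine card_bijective (fun q => (q.2.1, q.1, q.2.2))
    (Function.Involutive.bijective fun _ => rfl) fun q => ?_
  simp only [mem_filter, mem_product, distTriple, Prod.mk.injEq, hammingDist_comm q.2.1 q.1]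
  tauto

theorem tripleCount_swap_right (C : Finset (BinHamming n)) (a b c : ℕ) :
    tripleCount C C (a, b, c) = tripleCount C C (a, c, b) := by
  refine card_bijective (fun q => (q.1, q.2.2, q.2.1))
    (Function.Involutive.bijective fun _ => rfl) fun q => ?_
  simp only [mem_filter, mem_product, distTriple, Prod.mk.injEq, hammingDist_comm q.2.2 q.2.1]
  tauto

theorem tripleCount_eq_sum (C Z : Finset (BinHamming n)) (p : ℕ × ℕ × ℕ) :
    tripleCount C Z p = ∑ x ∈ C, ∑ y ∈ C, #{z ∈ Z | distTriple x y z = p} := by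
  simp only [tripleCount, card_filter, sum_product]

theorem tripleCount_zero_left (C : Finset (BinHamming n)) (c : ℕ) :
    tripleCount C C (0, c, c) = ∑ x ∈ C, ∑ y ∈ C, if hammingDist x y = c then 1 else 0 := by
  rw [tripleCount_eq_sum]
  refine sum_congr rfl fun x _ => sum_congr rfl fun y hy => ?_
  split_ifs with hc
  · rw [card_eq_one]
    refine ⟨y, ?_⟩
    ext z
    simp only [distTriple, mem_filter, Prod.mk.injEq, hammingDist_eq_zero, mem_singleton]
    exact ⟨fun h => h.2.1.symm, by rintro rfl; exact ⟨hy, rfl, hc, hc⟩⟩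
  · simp [distTriple, hc]

theorem card_filter_card_inter_card_sdiff {α : Type*} [Fintype α] [DecidableEq α] (S : Finset α)
    (i j : ℕ) :
    #{D : Finset α | #(D ∩ S) = i ∧ #(D \ S) = j} = (#S).choose i * (#Sᶜ).choose j := by
  rw [← card_powersetCard, ← card_powersetCard, ← card_product]
  have split_union {A : Finset α × Finset α} (hA : A.1 ⊆ S ∧ A.2 ⊆ Sᶜ) :
      (A.1 ∪ A.2) ∩ S = A.1 ∧ (A.1 ∪ A.2) \ S = A.2 := by
    have hA' : Disjoint A.2 S := subset_compl_iff_disjoint_right.mp hA.2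
    rw [union_inter_distrib_right, inter_eq_left.mpr hA.1, 
      disjoint_iff_inter_eq_empty.mp hA', union_empty,
      union_sdiff_distrib, sdiff_eq_empty_iff_subset.mpr hA.1, sdiff_eq_self_of_disjoint hA',
      empty_union]
    exact ⟨rfl, rfl⟩
  refine card_nbij' (fun D => (D ∩ S, D \ S)) (fun A => A.1 ∪ A.2) (fun D hD => ?_)
    (fun A hA => ?_) (fun D _ => ?_) fun A hA => ?_
  · simp_all [mem_powersetCard, subset_compl_iff_disjoint_right, sdiff_disjoint]
  · simp only [coe_product, Set.mem_prod, mem_coe, mem_powersetCard] at hA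
    simp [split_union ⟨hA.1.1, hA.2.1⟩, hA]
  · exact (union_comm _ _).trans (sdiff_union_inter D S)
  · simp only [coe_product, Set.mem_prod, mem_coe, mem_powersetCard] at hA
    exact Prod.ext_iff.mpr (split_union ⟨hA.1.1, hA.2.1⟩)

theorem card_filter_hammingDist_eq_tCount (x y : BinHamming n) {a b : ℕ}
    (h : (a, b, hammingDist x y) ∈ Omega n) :
    #{z : BinHamming n | hammingDist y z = a ∧ hammingDist x z = b}
      = tCount n a b (hammingDist x y) := by
  simp only [Omega, mem_filter] at h
  rw [tCount, ← card_diffSet, show n - #(diffSet x y) = #(diffSet x y)ᶜ by simp [card_compl],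
    ← card_filter_card_inter_card_sdiff]
  refine card_bijective _ (diffSet_left_bijective y) fun z => ?_
  have hxy := card_diffSet x y
  have hz := card_inter_add_card_sdiff (diffSet z y) (diffSet x y)
  have hxz := hammingDist_add_two_mul_card_inter z x y
  rw [card_diffSet z y] at hz
  rw [hammingDist_comm z x] at hxz
  simp only [mem_filter, mem_univ, true_and, hammingDist_comm y z]
  omega

theorem tripleCount_univ (C : Finset (BinHamming n)) {a b c : ℕ} (h : (a, b, c) ∈ Omega n) :
    tripleCount C univ (a, b, c) = tCount n a b c * tripleCount C C (0, c, c) := by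
  rw [tripleCount_zero_left, tripleCount_eq_sum]
  simp only [mul_sum]
  refine sum_congr rfl fun x _ => sum_congr rfl fun y _ => ?_
  split_ifs with hc
  · subst hc
    simp [distTriple, card_filter_hammingDist_eq_tCount x y h]
  · simp [distTriple, hc]

theorem tripleCount_add_tripleCount_compl (C : Finset (BinHamming n)) (p : ℕ × ℕ × ℕ) :
    tripleCount C C p + tripleCount C Cᶜ p = tripleCount C univ p := by
  simp only [tripleCount_eq_sum, ← sum_add_distrib, card_filter, sum_add_sum_compl]

end Triples

section TripleDistribution

open Finset

variable {n : ℕ}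

theorem tripleDistribution_eq (C : Finset (BinHamming n)) (a b c : ℕ) :
    tripleDistribution C a b c = 1 / #C * tripleCount C C (a, b, c) := by
  simp only [tripleDistribution, tripleCount, distTriple, Prod.mk.injEq]

theorem tripleDistribution_swap_left (C : Finset (BinHamming n)) (a b c : ℕ) :
    tripleDistribution C a b c = tripleDistribution C b a c := by
  rw [tripleDistribution_eq, tripleCount_swap_left, ← tripleDistribution_eq]

theorem tripleDistribution_swap_right (C : Finset (BinHamming n)) (a b c : ℕ) :
    tripleDistribution C a b c = tripleDistribution C a c b := by
  rw [tripleDistribution_eq, tripleCount_swap_right, ← tripleDistribution_eq]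

theorem apply_perm_eq_of_swaps {α β : Type*} {f : α → α → α → β}
    (hleft : ∀ a b c, f a b c = f b a c) (hright : ∀ a b c, f a b c = f a c b)
    (p : Fin 3 → α) (τ : Equiv.Perm (Fin 3)) :
    f (p 0) (p 1) (p 2) = f (p (τ 0)) (p (τ 1)) (p (τ 2)) := by
  have hτ : ∀ τ : Equiv.Perm (Fin 3), (τ 0, τ 1, τ 2) ∈
      ({(0, 1, 2), (0, 2, 1), (1, 0, 2), (1, 2, 0), (2, 0, 1), (2, 1, 0)} :
        Finset (Fin 3 × Fin 3 × Fin 3)) := by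
    decide
  have := hτ τ
  simp only [mem_insert, mem_singleton, Prod.mk.injEq] at this
  grind

theorem tCount_mul_tripleDistribution (C : Finset (BinHamming n)) {a b c : ℕ}
    (h : (a, b, c) ∈ Omega n) :
    tCount n a b c * tripleDistribution C 0 c c
      = tripleDistribution C a b c + 1 / #C * tripleCount C Cᶜ (a, b, c) := by
  have hcount : (tCount n a b c * tripleCount C C (0, c, c) : ℝ)
      = tripleCount C C (a, b, c) + tripleCount C Cᶜ (a, b, c) := by
    exact_mod_cast (tripleCount_univ C h).symm.trans (tripleCount_add_tripleCount_compl C _).symm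
  rw [tripleDistribution_eq, tripleDistribution_eq, mul_left_comm, hcount, mul_add]

theorem tripleDistribution_le (C : Finset (BinHamming n)) {a b c : ℕ} (h : (a, b, c) ∈ Omega n) :
    tripleDistribution C a b c ≤ tCount n a b c * tripleDistribution C 0 c c := by
  rw [tCount_mul_tripleDistribution C h]
  exact le_add_of_nonneg_right (by positivity)

theorem tripleDistribution_eq_zero (C : Finset (BinHamming n)) {a b c : ℕ}
    (h : ∀ x ∈ C, ∀ y ∈ C, ∀ z ∈ C, distTriple x y z ≠ (a, b, c)) :
    tripleDistribution C a b c = 0 := by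
  have hcount : tripleCount C C (a, b, c) = 0 := by
    rw [tripleCount, card_eq_zero, filter_eq_empty_iff]
    rintro ⟨x, y, z⟩ hq
    simp only [mem_product] at hq
    exact h x hq.1 y hq.2.1 z hq.2.2
  rw [tripleDistribution_eq, hcount, Nat.cast_zero, mul_zero]

theorem tripleDistribution_zero {C : Finset (BinHamming n)} (hC : C.Nonempty) :
    tripleDistribution C 0 0 0 = 1 := by
  have hcard : (#C : ℝ) ≠ 0 := Nat.cast_ne_zero.mpr hC.card_ne_zero
  have hcount : tripleCount C C (0, 0, 0) = #C := by
    rw [tripleCount_zero_left]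
    simp [hammingDist_eq_zero]
  rw [tripleDistribution_eq, hcount, one_div_mul_cancel hcard]

theorem rotate_mem_Omega {a b c : ℕ} (h : (a, b, c) ∈ Omega n) : (b, c, a) ∈ Omega n := by
  simp only [Omega, mem_filter, mem_product, mem_range] at h ⊢
  omega

/-- No triple of elements of `C`, with repetitions allowed, has its distances in the forbidden set
`I`. -/
def AvoidsDistTriples (C : Finset (BinHamming n)) (I : Set (ℕ × ℕ × ℕ)) : Prop :=
  ∀ x ∈ C, ∀ y ∈ C, ∀ z ∈ C, distTriple x y z ∉ I

theorem sdpFeasible_tripleDistribution {C : Finset (BinHamming n)} {I : Set (ℕ × ℕ × ℕ)}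
    (hC : C.Nonempty) (hI : AvoidsDistTriples C I) : SDPFeasible n I (tripleDistribution C) where
  support a b c h := tripleDistribution_eq_zero C fun x _ y _ z _ hxyz =>
    h (hxyz ▸ distTriple_mem_Omega x y z)
  normalized := tripleDistribution_zero hC
  nonneg a b c _ := by rw [tripleDistribution]; positivity
  symm p τ _ := apply_perm_eq_of_swaps (tripleDistribution_swap_left C)
    (tripleDistribution_swap_right C) p τ
  le_c a b c h := tripleDistribution_le C h
  le_a a b c h := by
    rw [tripleDistribution_swap_left, tripleDistribution_swap_right]
    exact tripleDistribution_le C (rotate_mem_Omega h)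
  le_b a b c h := by
    rw [tripleDistribution_swap_right, tripleDistribution_swap_left]
    exact tripleDistribution_le C (rotate_mem_Omega (rotate_mem_Omega h))
  psd k _ := by
    simp only [tripleDistribution_eq, mul_smul, ← smul_sum]
    exact (posSemidef_sum_tripleCount_smul k C C).smul (by positivity)
  psd_compl k _ := by
    have hsub : ∀ p ∈ Omega n, (tCount n p.1 p.2.1 p.2.2 : ℝ) * tripleDistribution C 0 p.2.2 p.2.2
        - tripleDistribution C p.1 p.2.1 p.2.2 = 1 / #C * tripleCount C Cᶜ p := fun p hp => by
      rw [tCount_mul_tripleDistribution C hp, add_sub_cancel_left]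
    rw [sum_congr rfl fun p hp => by rw [hsub p hp, mul_smul], ← smul_sum]
    exact (posSemidef_sum_tripleCount_smul k C Cᶜ).smul (by positivity)
  vanish a b c _ h := tripleDistribution_eq_zero C fun x hx y hy z hz hxyz =>
    hI x hx y hy z hz (hxyz ▸ h)

theorem sdpObjective_tripleDistribution {C : Finset (BinHamming n)} (hC : C.Nonempty) :
    sdpObjective n (tripleDistribution C) = #C := by
  have hcard : (#C : ℝ) ≠ 0 := Nat.cast_ne_zero.mpr hC.card_ne_zero
  have hmem (x y : BinHamming n) : hammingDist x y < n + 1 :=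
    Nat.lt_succ_of_le (by simpa using hammingDist_le_card_fintype (x := x) (y := y))
  have hcount : ∑ c ∈ range (n + 1), tripleCount C C (0, c, c) = #C * #C := by
    simp only [tripleCount_zero_left]
    rw [sum_comm, sum_congr rfl fun x _ => sum_comm]
    simp [hmem]
  simp only [sdpObjective, tripleDistribution_eq]
  rw [← mul_sum, ← Nat.cast_sum, hcount, Nat.cast_mul, ← mul_assoc, one_div_mul_cancel hcard,
    one_mul]

end TripleDistribution

/-! ### Medians and radii -/

section Geodesics

open Finset

variable {ι : Type*} [Fintype ι] {β : ι → Type*} [∀ j, DecidableEq (β j)]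

theorem hammingDist_add_hammingDist_of_between {x y m : ∀ j, β j}
    (hm : ∀ j, m j = x j ∨ m j = y j) :
    hammingDist m x + hammingDist m y = hammingDist x y := by
  simp only [hammingDist, card_filter, ← sum_add_distrib]
  refine sum_congr rfl fun j _ => ?_
  rcases hm j with hj | hj <;> simp [hj, eq_comm]

theorem exists_between_hammingDist_eq (x y : ∀ j, β j) {k : ℕ} (hk : k ≤ hammingDist x y) :
    ∃ u : ∀ j, β j, hammingDist u x = k ∧ hammingDist u x + hammingDist u y = hammingDist x y := by
  classical
  obtain ⟨W, hW, hWk⟩ := exists_subset_card_eq hk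
  refine ⟨W.piecewise y x, ?_, hammingDist_add_hammingDist_of_between fun j => ?_⟩
  · rw [← hWk, hammingDist]
    congr 1
    ext j
    by_cases hj : j ∈ W
    · simpa [hj, eq_comm] using hW hj
    · simp [hj]
  · by_cases hj : j ∈ W <;> simp [hj]

/-- Starting at `m`, walk towards the only point that can be too far away. -/
theorem exists_forall_hammingDist_le {κ : Type*} {x : κ → ∀ j, β j} {m : ∀ j, β j} {ρ : ℕ}
    (h : Pairwise fun i i' => hammingDist m (x i) + hammingDist m (x i') ≤ 2 * ρ) :
    ∃ u : ∀ j, β j, ∀ i, hammingDist u (x i) ≤ ρ := by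
  by_cases hfar : ∃ i, ρ < hammingDist m (x i)
  · obtain ⟨i, hi⟩ := hfar
    obtain ⟨u, hum, hui⟩ :=
      exists_between_hammingDist_eq m (x i) (Nat.sub_le (hammingDist m (x i)) ρ)
    refine ⟨u, fun i' => ?_⟩
    rcases eq_or_ne i i' with rfl | hii'
    · omega
    · have htri := hammingDist_triangle u m (x i')
      have := h hii'
      omega
  · exact ⟨m, by simpa using hfar⟩

end Geodesics

section Radius

open Finset

variable {n : ℕ}

theorem exists_median (x : Fin 3 → BinHamming n) :
    ∃ m : BinHamming n, Pairwise fun i i' =>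
      hammingDist m (x i) + hammingDist m (x i') = hammingDist (x i) (x i') := by
  have hmajority : ∀ v : Fin 3 → ZMod 2, ∃ b, ∀ i i', i ≠ i' → b = v i ∨ b = v i' := by
    decide
  choose m hm using fun j => hmajority fun i => x i j
  exact ⟨m, fun i i' hii' => hammingDist_add_hammingDist_of_between fun j => hm j i i' hii'⟩

theorem radius_le {x : Fin 3 → BinHamming n} {ρ : ℕ}
    (h : Pairwise fun i i' => hammingDist (x i) (x i') ≤ 2 * ρ) : radius x ≤ ρ := by
  obtain ⟨m, hm⟩ := exists_median x
  exact Nat.sInf_le (exists_forall_hammingDist_le fun i i' hii' => (hm hii').trans_le (h hii'))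

theorem six_mul_avgRadius_le (x : Fin 3 → BinHamming n) :
    6 * avgRadius x
      ≤ hammingDist (x 1) (x 2) + hammingDist (x 0) (x 2) + hammingDist (x 0) (x 1) := by
  obtain ⟨m, hm⟩ := exists_median x
  have hle : avgRadius x ≤ 1 / (3 : ℕ) * ∑ i, (hammingDist m (x i) : ℝ) :=
    ciInf_le (Set.finite_range _).bddBelow m
  rw [Fin.sum_univ_three] at hle
  rw [← hm (by decide : (1 : Fin 3) ≠ 2), ← hm (by decide : (0 : Fin 3) ≠ 2),
    ← hm (by decide : (0 : Fin 3) ≠ 1)]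
  push_cast at hle ⊢
  linarith

theorem two_mul_genDist (x : Fin 3 → BinHamming n) :
    2 * genDist x
      = hammingDist (x 1) (x 2) + hammingDist (x 0) (x 2) + hammingDist (x 0) (x 1) := by
  simp only [genDist, hammingDist, card_filter, mul_sum, ← sum_add_distrib]
  refine sum_congr rfl fun j _ => ?_
  have hcoord : ∀ v : Fin 3 → ZMod 2, 2 * (if ∃ i i', v i ≠ v i' then 1 else 0)
      = (if v 1 ≠ v 2 then 1 else 0) + (if v 0 ≠ v 2 then 1 else 0)
        + if v 0 ≠ v 1 then 1 else 0 := by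
    decide
  exact hcoord fun i => x i j

theorem avoidsDistTriples_of_le_codeMin {f : (Fin 3 → BinHamming n) → ℝ} {r : ℝ}
    {C : Finset (BinHamming n)} {I : Set (ℕ × ℕ × ℕ)} (h : (r : EReal) ≤ codeMin f C)
    (hI : ∀ p ∈ I, p.1 * p.2.1 * p.2.2 ≠ 0)
    (hf : ∀ x : Fin 3 → BinHamming n, distTriple (x 0) (x 1) (x 2) ∈ I → f x < r) :
    AvoidsDistTriples C I := by
  intro x hx y hy z hz hxyz
  have hne := hI _ hxyz
  simp only [distTriple, mul_ne_zero_iff, hammingDist_ne_zero] at hne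
  have hinj : Function.Injective ![x, y, z] := by
    intro i i' hii'
    fin_cases i <;> fin_cases i' <;> simp_all [eq_comm]
  have hmem : ∀ i, ![x, y, z] i ∈ C := by simp [Fin.forall_fin_succ, hx, hy, hz]
  have hle : (r : EReal) ≤ f ![x, y, z] := le_iInf_iff.mp h ⟨![x, y, z], hinj, hmem⟩
  exact (hf ![x, y, z] hxyz).not_ge (EReal.coe_le_coe_iff.mp hle)

theorem avoidsDistTriples_forbidD {C : Finset (BinHamming n)} {d : ℕ}
    (h : ((d : ℝ) : EReal) ≤ d₂ C) : AvoidsDistTriples C (forbidD d) := by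
  refine avoidsDistTriples_of_le_codeMin h (fun p hp => hp.1) fun x hx => ?_
  have hle : (hammingDist (x 1) (x 2) : ℤ) + hammingDist (x 0) (x 2) + hammingDist (x 0) (x 1)
    ≤ 2 * ((d : ℤ) - 1) := hx.2
  have hgen := two_mul_genDist x
  exact_mod_cast (by omega : genDist x < d)

theorem avoidsDistTriples_forbidR {C : Finset (BinHamming n)} {r : ℕ}
    (h : ((r : ℝ) : EReal) ≤ r₂ C) : AvoidsDistTriples C (forbidR r) := by
  refine avoidsDistTriples_of_le_codeMin h (fun p hp => hp.1) fun x hx => ?_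
  have hceil {a : ℕ} (ha : (a : ℝ) / 2 ≤ ((r - 1 : ℤ) : ℝ)) : a + 2 ≤ 2 * r := by
    push_cast at ha
    exact_mod_cast (by linarith : (a : ℝ) + 2 ≤ 2 * r)
  have hmax := hx.2
  simp only [distTriple, max_le_iff, Int.ceil_le] at hmax
  have h₁₂ := hceil hmax.1.1
  have h₀₂ := hceil hmax.1.2
  have h₀₁ := hceil hmax.2
  have hrad : radius x ≤ r - 1 := radius_le fun
    | 0, 0, h | 1, 1, h | 2, 2, h => absurd rfl h
    | 0, 1, _ | 0, 2, _ | 1, 2, _ => by dsimp only; omega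
    | 1, 0, _ | 2, 0, _ | 2, 1, _ => by dsimp only; rw [hammingDist_comm]; omega
  exact_mod_cast (by omega : radius x < r)

theorem avoidsDistTriples_forbidRbar {C : Finset (BinHamming n)} {ρ : ℝ}
    (h : (ρ : EReal) ≤ rbar₂ C) : AvoidsDistTriples C (forbidRbar ρ) := by
  refine avoidsDistTriples_of_le_codeMin h (fun p hp => hp.1) fun x hx => ?_
  have hlt : (hammingDist (x 1) (x 2) : ℝ) + hammingDist (x 0) (x 2) + hammingDist (x 0) (x 1)
    < 6 * ρ := hx.2
  linarith [six_mul_avgRadius_le x]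

end Radius

/-! ### The optimum -/

section Optimum

theorem isClosed_setOf_posSemidef {ι : Type*} [Finite ι] :
    IsClosed {M : Matrix ι ι ℝ | M.PosSemidef} := by
  cases nonempty_fintype ι
  simp only [Matrix.posSemidef_iff_dotProduct_mulVec, Matrix.IsHermitian, Set.ofPred_and,
    Set.ofPred_forall]
  refine IsClosed.inter (isClosed_eq (by fun_prop) continuous_id) (isClosed_iInter fun v => ?_)
  exact isClosed_le continuous_const (by fun_prop)

variable {n : ℕ} {I : Set (ℕ × ℕ × ℕ)}

theorem isClosed_setOf_sdpFeasible (n : ℕ) (I : Set (ℕ × ℕ × ℕ)) :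
    IsClosed {x | SDPFeasible n I x} := by
  refine isClosed_of_closure_subset fun x hx => ?_
  have of_closed {P : (ℕ → ℕ → ℕ → ℝ) → Prop} (hP : IsClosed {y | P y})
      (h : ∀ y, SDPFeasible n I y → P y) : P x := closure_minimal h hP hx
  exact {
    support := fun a b c h => of_closed (isClosed_eq (by fun_prop) continuous_const)
      fun y hy => hy.support a b c h
    normalized := of_closed (isClosed_eq (by fun_prop) continuous_const) fun y hy => hy.normalized
    nonneg := fun a b c h => of_closed (isClosed_le continuous_const (by fun_prop))
      fun y hy => hy.nonneg a b c h
    symm := fun p τ h => of_closed (isClosed_eq (by fun_prop) (by fun_prop))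
      fun y hy => hy.symm p τ h
    le_c := fun a b c h => of_closed (isClosed_le (by fun_prop) (by fun_prop))
      fun y hy => hy.le_c a b c h
    le_a := fun a b c h => of_closed (isClosed_le (by fun_prop) (by fun_prop))
      fun y hy => hy.le_a a b c h
    le_b := fun a b c h => of_closed (isClosed_le (by fun_prop) (by fun_prop))
      fun y hy => hy.le_b a b c h
    psd := fun k hk => of_closed (isClosed_setOf_posSemidef.preimage (by fun_prop))
      fun y hy => hy.psd k hk
    psd_compl := fun k hk => of_closed (isClosed_setOf_posSemidef.preimage (by fun_prop))
      fun y hy => hy.psd_compl k hk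
    vanish := fun a b c h hI => of_closed (isClosed_eq (by fun_prop) continuous_const)
      fun y hy => hy.vanish a b c h hI }

theorem mem_Icc_of_sdpFeasible {x : ℕ → ℕ → ℕ → ℝ} (hx : SDPFeasible n I x) (a b c : ℕ) :
    x a b c ∈ Set.Icc (0 : ℝ) (tCount n a b c * tCount n c c 0) := by
  by_cases h : (a, b, c) ∈ Omega n
  · have h₀ : (0, c, c) ∈ Omega n := by
      simp only [Omega, Finset.mem_filter, Finset.mem_product, Finset.mem_range] at h ⊢
      omega
    have hcc : x 0 c c ≤ tCount n c c 0 := by simpa [hx.normalized] using hx.le_a 0 c c h₀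
    exact ⟨hx.nonneg a b c h,
      (hx.le_c a b c h).trans (mul_le_mul_of_nonneg_left hcc (Nat.cast_nonneg _))⟩
  · rw [hx.support a b c h]
    exact ⟨le_rfl, by positivity⟩

theorem isCompact_setOf_sdpFeasible (n : ℕ) (I : Set (ℕ × ℕ × ℕ)) :
    IsCompact {x | SDPFeasible n I x} :=
  (isCompact_univ_pi fun a => isCompact_univ_pi fun b => isCompact_univ_pi fun c =>
    isCompact_Icc (a := (0 : ℝ)) (b := tCount n a b c * tCount n c c 0)).of_isClosed_subset
      (isClosed_setOf_sdpFeasible n I) fun _ hx a _ b _ c _ => mem_Icc_of_sdpFeasible hx a b c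

theorem isCompact_sdpValues (n : ℕ) (I : Set (ℕ × ℕ × ℕ)) : IsCompact (sdpValues n I) :=
  (isCompact_setOf_sdpFeasible n I).image (by unfold sdpObjective; fun_prop)

theorem isGreatest_sdpOptimum (hI : (0, 0, 0) ∉ I) :
    IsGreatest (sdpValues n I) (sdpOptimum n I) := by
  have havoid : AvoidsDistTriples ({0} : Finset (BinHamming n)) I := by
    simpa [AvoidsDistTriples, distTriple] using hI
  exact (isCompact_sdpValues n I).isGreatest_sSup ⟨_, Set.mem_image_of_mem _
    (sdpFeasible_tripleDistribution (Finset.singleton_nonempty 0) havoid)⟩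

theorem card_le_sdpOptimum {C : Finset (BinHamming n)} (hI : (0, 0, 0) ∉ I)
    (hC : AvoidsDistTriples C I) : (C.card : ℝ) ≤ sdpOptimum n I := by
  rcases C.eq_empty_or_nonempty with rfl | hne
  · obtain ⟨x, hx, hxopt⟩ := (isGreatest_sdpOptimum hI).1
    rw [← hxopt, Finset.card_empty, Nat.cast_zero]
    exact Finset.sum_nonneg fun c _ => (mem_Icc_of_sdpFeasible hx 0 c c).1
  · exact (isGreatest_sdpOptimum hI).2 ⟨_, sdpFeasible_tripleDistribution hne hC,
      sdpObjective_tripleDistribution hne⟩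

theorem sdpBound_of_avoidsDistTriples {C : Finset (BinHamming n)} (hI : (0, 0, 0) ∉ I)
    (hC : AvoidsDistTriples C I) :
    (C.Nonempty → SDPFeasible n I (tripleDistribution C) ∧
        sdpObjective n (tripleDistribution C) = (C.card : ℝ)) ∧
      IsGreatest (sdpValues n I) (sdpOptimum n I) ∧ (C.card : ℝ) ≤ sdpOptimum n I :=
  ⟨fun hne => ⟨sdpFeasible_tripleDistribution hne hC, sdpObjective_tripleDistribution hne⟩,
    isGreatest_sdpOptimum hI, card_le_sdpOptimum hI hC⟩

end Optimum

theorem mainTheorem1 (n : ℕ) (C : Finset (BinHamming n)) :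
    (∀ d : ℕ, ((d : ℝ) : EReal) ≤ d₂ C →
      (C.Nonempty → SDPFeasible n (forbidD d) (tripleDistribution C) ∧
        sdpObjective n (tripleDistribution C) = (C.card : ℝ)) ∧
      IsGreatest (sdpValues n (forbidD d)) (sdpOptimum n (forbidD d)) ∧
      (C.card : ℝ) ≤ sdpOptimum n (forbidD d)) ∧
    (∀ r : ℕ, ((r : ℝ) : EReal) ≤ r₂ C →
      (C.Nonempty → SDPFeasible n (forbidR r) (tripleDistribution C) ∧
        sdpObjective n (tripleDistribution C) = (C.card : ℝ)) ∧
      IsGreatest (sdpValues n (forbidR r)) (sdpOptimum n (forbidR r)) ∧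
      (C.card : ℝ) ≤ sdpOptimum n (forbidR r)) ∧
    (∀ ρ : ℝ, (ρ : EReal) ≤ rbar₂ C →
      (C.Nonempty → SDPFeasible n (forbidRbar ρ) (tripleDistribution C) ∧
        sdpObjective n (tripleDistribution C) = (C.card : ℝ)) ∧
      IsGreatest (sdpValues n (forbidRbar ρ)) (sdpOptimum n (forbidRbar ρ)) ∧
      (C.card : ℝ) ≤ sdpOptimum n (forbidRbar ρ)) := by
  refine ⟨fun d hd => ?_, fun r hr => ?_, fun ρ hρ => ?_⟩
  · exact sdpBound_of_avoidsDistTriples (by simp [forbidD]) (avoidsDistTriples_forbidD hd)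
  · exact sdpBound_of_avoidsDistTriples (by simp [forbidR]) (avoidsDistTriples_forbidR hr)
  · exact sdpBound_of_avoidsDistTriples (by simp [forbidRbar]) (avoidsDistTriples_forbidRbar hρ)
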